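/- Let $E$ be an infinite-dimensional real Banach space with an unconditional Schauder basis $(e_n)_{n\in\mathbb N}$. Suppose that $E$ has an equivalent norm $N$ that is of class $C^1$ on $E\setminus\{0\}$ and locally depends on finitely many coordinates. The latter means that for every $x\in E\setminus\{0\}$ there are an open neighbourhood $V$ of $x$, a number $l\in\mathbb N$, functionals $L_1,\dots,L_l\in E^*$ and a function $\gamma:\mathbb R^l\to\mathbb R$ such that $N(y)=\gamma(L_1(y),\dots,L_l(y))$ for every $y\in V$. Then for every open set $U\subseteq E$ there exists a $C^1$ function $\lambda:E\to[0,\infty)$ whose support $\overline{\{x\in E:\lambda(x)\neq 0\}}$ is the closure $\overline U$ and which has no critical point in $U$, that is, the derivative $D\lambda(x):E\to\mathbb R$ is surjective for every $x\in U$. In particular, the space $c_0$ of real null sequences with the supremum norm satisfies these hypotheses, and so the conclusion holds for $E=c_0$. -/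

import Mathlib

open scoped ZeroAtInfty

/-- The seminorm `N` is a norm equivalent to the given norm of `E`. -/
def IsEquivalentNorm {E : Type*} [NormedAddCommGroup E] [NormedSpace ℝ E]
    (N : Seminorm ℝ E) : Prop :=
  ∃ c C : ℝ, 0 < c ∧ 0 < C ∧ ∀ x : E, c * ‖x‖ ≤ N x ∧ N x ≤ C * ‖x‖

/-- A norm is of class `C^1` if it is a `C^1` function away from the origin. -/
def IsC1Norm {E : Type*} [NormedAddCommGroup E] [NormedSpace ℝ E]
    (N : Seminorm ℝ E) : Prop :=
  ContDiffOn ℝ 1 (fun x : E => N x) {0}ᶜ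

/-- `N` locally depends on finitely many coordinates: near every nonzero point `x` it factors
through finitely many continuous linear functionals. (The origin has to be left out: near it, no
norm on an infinite-dimensional space factors in this way.) -/
def LocallyDependsOnFinitelyManyCoordinates {E : Type*} [NormedAddCommGroup E] [NormedSpace ℝ E]
    (N : Seminorm ℝ E) : Prop :=
  ∀ x : E, x ≠ 0 → ∃ (l : ℕ) (V : Set E) (L : Fin l → StrongDual ℝ E) (γ : (Fin l → ℝ) → ℝ),
    IsOpen V ∧ x ∈ V ∧ ∀ y ∈ V, N y = γ (fun i => L i y)

/-- `E` is infinite-dimensional, has an unconditional (Schauder) basis, and has a `C^1` equivalent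
norm that locally depends on finitely many coordinates. -/
structure HasC1FiniteCoordinateNorm (E : Type*) [NormedAddCommGroup E] [NormedSpace ℝ E] :
    Prop where
  infinite_dimensional : ¬ FiniteDimensional ℝ E
  unconditional_basis : Nonempty (UnconditionalSchauderBasis ℕ ℝ E)
  exists_norm : ∃ N : Seminorm ℝ E,
    IsEquivalentNorm N ∧ IsC1Norm N ∧ LocallyDependsOnFinitelyManyCoordinates N

/-!
Near a nonzero point `N` factors through finitely many functionals, so its derivative there lies in
their span. Covering `E \ {0}` by countably many such neighbourhoods puts all derivatives of `N` in
a subspace `W` of `E*` of countable dimension. The Banach space `E*` is infinite-dimensional, so by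
Baire's theorem there is a sequence `f n` in `E*` that is linearly independent modulo `W`.

Composing translates of `N` with bump functions on the line gives nonnegative cutoffs `ψ n` with
derivatives in `W` whose supports cover `U`, only finitely many of them being nonzero near any given
point of `U`. Multiply `ψ n` by the positive function `2 + arctan ∘ f n` and put
`λ = ∑ c n • ψ n • (2 + arctan ∘ f n)`. Modulo `W`, the derivative of `λ` at `x ∈ U` is a finite
combination of the `f n` whose coefficient at `f n` is a positive multiple of `ψ n x`. One of these
is nonzero, hence so is the derivative. Small weights `c n` make the series converge in `C¹` on all
of `E`, including at the boundary of `U`.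

On `c₀` let `Φ x = ∑ n, φ (x n)`, where `φ` is a convex even `C¹` function vanishing exactly on
`[-1, 1]`. Near any point all but finitely many coordinates are smaller than `1`, so `Φ` is locally
a finite sum. The required norm is the gauge of `{Φ ≤ 1}`: along a ray `Φ` is convex and increases
through the level `1`, so the implicit function theorem gives the smoothness of the gauge.
-/

open Set Filter Topology
open scoped Cardinal

section LinearAlgebra

theorem exists_nat_linearIndependent_of_not_finite (R M : Type*) [Semiring R] [AddCommMonoid M]
    [Module R M] [Module.Free R M] (h : ¬ Module.Finite R M) :
    ∃ v : ℕ → M, LinearIndependent R v := by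
  let b := Module.Free.chooseBasis R M
  have : Infinite (Module.Free.ChooseBasisIndex R M) :=
    not_finite_iff_infinite.1 fun _ => h (Module.Finite.of_basis b)
  exact ⟨_, b.linearIndependent.comp _ (Infinite.natEmbedding _).injective⟩

variable {𝕜 E : Type*} [NontriviallyNormedField 𝕜] [AddCommGroup E] [Module 𝕜 E]
  [TopologicalSpace E]

theorem mem_span_range_of_forall_apply_eq_zero [IsTopologicalAddGroup E] {ι : Type*} [Finite ι]
    {L : ι → StrongDual 𝕜 E} {f : StrongDual 𝕜 E} (h : ∀ v, (∀ i, L i v = 0) → f v = 0) :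
    f ∈ Submodule.span 𝕜 (range L) := by
  have := Fintype.ofFinite ι
  have hspan : f.toLinearMap ∈ Submodule.span 𝕜 (range fun i => (L i).toLinearMap) :=
    mem_span_of_iInf_ker_le_ker fun v hv => h v (by simpa using hv)
  obtain ⟨c, hc⟩ := (Submodule.mem_span_range_iff_exists_fun 𝕜).1 hspan
  refine (Submodule.mem_span_range_iff_exists_fun 𝕜).2 ⟨c, ?_⟩
  ext v
  simpa using LinearMap.congr_fun hc v

theorem finiteDimensional_of_strongDual [IsTopologicalAddGroup E] [SeparatingDual 𝕜 E]
    [FiniteDimensional 𝕜 (StrongDual 𝕜 E)] : FiniteDimensional 𝕜 E := by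
  let eval : E →ₗ[𝕜] Module.Dual 𝕜 (StrongDual 𝕜 E) := (ContinuousLinearMap.coeLM 𝕜).flip
  refine FiniteDimensional.of_injective eval ((injective_iff_map_eq_zero eval).2 fun x hx => ?_)
  exact SeparatingDual.eq_zero_of_forall_dual_eq_zero (R := 𝕜) (LinearMap.congr_fun hx)

variable [CompleteSpace 𝕜] [IsTopologicalAddGroup E] [ContinuousSMul 𝕜 E] [T2Space E] [BaireSpace E]

theorem finiteDimensional_of_rank_le_aleph0 (h : Module.rank 𝕜 E ≤ ℵ₀) :
    FiniteDimensional 𝕜 E := by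
  let b := Module.Basis.ofVectorSpace 𝕜 E
  have : Countable (Module.Basis.ofVectorSpaceIndex 𝕜 E) :=
    Cardinal.mk_le_aleph0_iff.1 (b.mk_eq_rank''.trans_le h)
  let F : Finset (Module.Basis.ofVectorSpaceIndex 𝕜 E) → Submodule 𝕜 E :=
    fun s => Submodule.span 𝕜 (b '' s)
  have hF : ∀ s, FiniteDimensional 𝕜 (F s) := fun s =>
    FiniteDimensional.span_of_finite 𝕜 (s.finite_toSet.image b)
  have hcover : ⋃ s, (F s : Set E) = univ :=
    iUnion_eq_univ_iff.2 fun x => ⟨(b.repr x).support, b.mem_span_image.2 subset_rfl⟩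
  obtain ⟨s, hs⟩ := nonempty_interior_of_iUnion_of_closed
    (fun s => (F s).closed_of_finiteDimensional) hcover
  exact Module.finite_def.2 ((F s).eq_top_of_nonempty_interior' hs ▸
    (Submodule.fg_iff_finiteDimensional _).2 (hF s))

theorem not_finiteDimensional_quotient_of_rank_le_aleph0 (hE : ¬ FiniteDimensional 𝕜 E)
    {W : Submodule 𝕜 E} (hW : Module.rank 𝕜 W ≤ ℵ₀) : ¬ FiniteDimensional 𝕜 (E ⧸ W) := by
  intro _
  refine hE (finiteDimensional_of_rank_le_aleph0 (𝕜 := 𝕜) ?_)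
  rw [← Submodule.rank_quotient_add_rank W]
  exact Cardinal.add_le_aleph0.2 ⟨(Module.rank_lt_aleph0 𝕜 _).le, hW⟩

theorem exists_linearIndependent_mkQ_of_rank_le_aleph0 (hE : ¬ FiniteDimensional 𝕜 E)
    {W : Submodule 𝕜 E} (hW : Module.rank 𝕜 W ≤ ℵ₀) :
    ∃ f : ℕ → E, LinearIndependent 𝕜 fun n => W.mkQ (f n) := by
  obtain ⟨v, hv⟩ := exists_nat_linearIndependent_of_not_finite 𝕜 (E ⧸ W)
    (not_finiteDimensional_quotient_of_rank_le_aleph0 hE hW)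
  choose f hf using fun n => W.mkQ_surjective (v n)
  exact ⟨f, by simpa only [hf] using hv⟩

end LinearAlgebra

theorem separableSpace_of_generalSchauderBasis {β 𝕜 X : Type*} [Countable β]
    [NontriviallyNormedField 𝕜] [TopologicalSpace.SeparableSpace 𝕜] [NormedAddCommGroup X]
    [NormedSpace 𝕜 X] {L : SummationFilter β} [L.NeBot] (b : GeneralSchauderBasis β 𝕜 X L) :
    TopologicalSpace.SeparableSpace X := by
  have hspan := ((countable_range b.basis).isSeparable.span (R := 𝕜)).closure
  rw [← TopologicalSpace.isSeparable_univ_iff]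
  refine hspan.mono fun x _ => mem_closure_of_tendsto (b.tendsto_proj x) (.of_forall fun A => ?_)
  rw [b.proj_apply]
  exact Submodule.sum_mem _ fun i _ => Submodule.smul_mem _ _ (Submodule.subset_span ⟨i, rfl⟩)

section FinitelyManyFunctionals

/-- Near `x`, the value of `g` depends only on the values of finitely many continuous linear
functionals. Fibrewise form of a local factorisation `g y = γ (L₁ y, …, Lₗ y)`: it needs neither
`γ` nor an enumeration of the functionals. -/
def DependsOnFinitelyManyFunctionalsAt (𝕜 : Type*) {E F : Type*} [NontriviallyNormedField 𝕜]
    [NormedAddCommGroup E] [NormedSpace 𝕜 E] (g : E → F) (x : E) : Prop :=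
  ∃ s : Finset (StrongDual 𝕜 E), ∀ᶠ p : E × E in 𝓝 (x, x),
    (∀ L ∈ s, L p.1 = L p.2) → g p.1 = g p.2

theorem fderiv_apply_eq_zero_of_eventually_eq {𝕜 E F : Type*} [NontriviallyNormedField 𝕜]
    [NormedAddCommGroup E] [NormedSpace 𝕜 E] [NormedAddCommGroup F] [NormedSpace 𝕜 F]
    {g : E → F} {x v : E} (h : ∀ᶠ t : 𝕜 in 𝓝 0, g (x + t • v) = g x) : fderiv 𝕜 g x v = 0 := by
  by_cases hg : DifferentiableAt 𝕜 g x
  · exact (hg.hasFDerivAt.hasLineDerivAt v).unique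
      ((hasDerivAt_const (0 : 𝕜) (g x)).congr_of_eventuallyEq h)
  · rw [fderiv_zero_of_not_differentiableAt hg, zero_apply]

theorem DependsOnFinitelyManyFunctionalsAt.exists_fderiv_mem_span {𝕜 E : Type*}
    [NontriviallyNormedField 𝕜] [NormedAddCommGroup E] [NormedSpace 𝕜 E] {g : E → 𝕜} {x : E}
    (hg : DependsOnFinitelyManyFunctionalsAt 𝕜 g x) :
    ∃ s : Finset (StrongDual 𝕜 E),
      ∀ᶠ y in 𝓝 x, fderiv 𝕜 g y ∈ Submodule.span 𝕜 (s : Set (StrongDual 𝕜 E)) := by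
  obtain ⟨s, hs⟩ := hg
  have hdiag : ∀ᶠ y in 𝓝 x, ∀ᶠ p : E × E in 𝓝 (y, y),
      (∀ L ∈ s, L p.1 = L p.2) → g p.1 = g p.2 :=
    (continuous_id.prodMk continuous_id).continuousAt.eventually (eventually_eventually_nhds.2 hs)
  refine ⟨s, hdiag.mono fun y hy => ?_⟩
  rw [← Subtype.range_coe (s := (s : Set (StrongDual 𝕜 E)))]
  refine mem_span_range_of_forall_apply_eq_zero fun v hv => fderiv_apply_eq_zero_of_eventually_eq ?_
  have hline : Tendsto (fun t : 𝕜 => (y + t • v, y)) (𝓝 0) (𝓝 (y, y)) :=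
    Continuous.tendsto' (by fun_prop) _ _ (by simp)
  filter_upwards [hline.eventually hy] with t ht
  exact ht fun L hL => by simp [show L v = 0 from hv ⟨L, hL⟩]

theorem locallyDependsOnFinitelyManyCoordinates_iff {E : Type*} [NormedAddCommGroup E]
    [NormedSpace ℝ E] {N : Seminorm ℝ E} :
    LocallyDependsOnFinitelyManyCoordinates N ↔
      ∀ x : E, x ≠ 0 → DependsOnFinitelyManyFunctionalsAt ℝ N x := by
  classical
  refine forall₂_congr fun x _ => ⟨?_, ?_⟩
  · rintro ⟨l, V, L, γ, hVo, hxV, hV⟩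
    refine ⟨Finset.univ.image L, ?_⟩
    filter_upwards [prod_mem_nhds (hVo.mem_nhds hxV) (hVo.mem_nhds hxV)] with p hp h
    rw [hV _ hp.1, hV _ hp.2]
    exact congrArg γ (funext fun i => h _ (Finset.mem_image_of_mem L (Finset.mem_univ i)))
  · rintro ⟨s, hs⟩
    obtain ⟨V, hVo, hxV, hV⟩ := exists_nhds_square hs
    let L : Fin s.card → StrongDual ℝ E := fun i => s.equivFin.symm i
    have hfactors : Function.FactorsThrough (fun y : V => N y) fun y i => L i y := by
      intro y z hyz
      refine hV (show ((y : E), (z : E)) ∈ V ×ˢ V from ⟨y.2, z.2⟩) fun M hM => ?_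
      simpa [L] using congrFun hyz (s.equivFin ⟨M, hM⟩)
    exact ⟨s.card, V, L, Function.extend (fun (y : V) i => L i y) (fun y => N y) 0, hVo, hxV,
      fun y hy => (hfactors.extend_apply 0 ⟨y, hy⟩).symm⟩

end FinitelyManyFunctionals

theorem exists_rank_le_aleph0_forall_fderiv_mem {𝕜 E : Type*} [NontriviallyNormedField 𝕜]
    [NormedAddCommGroup E] [NormedSpace 𝕜 E] [SecondCountableTopology E] {g : E → 𝕜} {U : Set E}
    (hg : ∀ x ∈ U, DependsOnFinitelyManyFunctionalsAt 𝕜 g x) :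
    ∃ W : Submodule 𝕜 (StrongDual 𝕜 E), Module.rank 𝕜 W ≤ ℵ₀ ∧ ∀ x ∈ U, fderiv 𝕜 g x ∈ W := by
  choose s hs using fun x : U => (hg x x.2).exists_fderiv_mem_span
  obtain ⟨t, htc, ht⟩ := TopologicalSpace.countable_cover_nhds fun x : U =>
    continuousAt_subtype_val.eventually (hs x)
  let S : Set (StrongDual 𝕜 E) := ⋃ x ∈ t, s x
  have hS : S.Countable := htc.biUnion fun x _ => (s x).countable_toSet
  refine ⟨Submodule.span 𝕜 S, (rank_span_le S).trans hS.le_aleph0, fun y hy => ?_⟩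
  obtain ⟨x, hxt, hyx⟩ := mem_iUnion₂.1 (ht.ge (mem_univ (⟨y, hy⟩ : U)))
  have hsub : (s x : Set (StrongDual 𝕜 E)) ⊆ S :=
    subset_biUnion_of_mem (u := fun x : U => (s x : Set (StrongDual 𝕜 E))) hxt
  exact Submodule.span_mono hsub hyx

section BoundedC1

variable {E : Type*} [NormedAddCommGroup E] [NormedSpace ℝ E] {V W : Submodule ℝ (StrongDual ℝ E)}

/-- The algebra of bounded `C¹` functions with bounded derivative, all of whose derivatives lie in
`W`. The cutoff functions live here for a countably generated `W`; this is what makes it possible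
to perturb them by functionals that are independent modulo `W`. -/
def boundedC1 (W : Submodule ℝ (StrongDual ℝ E)) : Subalgebra ℝ (E → ℝ) where
  carrier := {g | ContDiff ℝ 1 g ∧ (∃ M, ∀ x, |g x| ≤ M ∧ ‖fderiv ℝ g x‖ ≤ M) ∧
    ∀ x, fderiv ℝ g x ∈ W}
  add_mem' := by
    rintro g h ⟨hg, ⟨M, hM⟩, hgW⟩ ⟨hh, ⟨M', hM'⟩, hhW⟩
    have hderiv (x : E) : fderiv ℝ (g + h) x = fderiv ℝ g x + fderiv ℝ h x :=
      fderiv_add (hg.differentiable one_ne_zero x) (hh.differentiable one_ne_zero x)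
    refine ⟨hg.add hh, ⟨M + M', fun x => ⟨?_, ?_⟩⟩, fun x => ?_⟩
    · exact (abs_add_le _ _).trans (add_le_add (hM x).1 (hM' x).1)
    · rw [hderiv]
      exact norm_add_le_of_le (hM x).2 (hM' x).2
    · rw [hderiv]
      exact W.add_mem (hgW x) (hhW x)
  mul_mem' := by
    rintro g h ⟨hg, ⟨M, hM⟩, hgW⟩ ⟨hh, ⟨M', hM'⟩, hhW⟩
    have hM0 : 0 ≤ M := (abs_nonneg _).trans (hM 0).1
    have hM'0 : 0 ≤ M' := (abs_nonneg _).trans (hM' 0).1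
    have hderiv (x : E) : fderiv ℝ (g * h) x = g x • fderiv ℝ h x + h x • fderiv ℝ g x :=
      fderiv_mul (hg.differentiable one_ne_zero x) (hh.differentiable one_ne_zero x)
    refine ⟨hg.mul hh, ⟨M * M' + M' * M, fun x => ⟨?_, ?_⟩⟩, fun x => ?_⟩
    · rw [Pi.mul_apply, abs_mul]
      exact (mul_le_mul (hM x).1 (hM' x).1 (abs_nonneg _) hM0).trans
        (le_add_of_nonneg_right (mul_nonneg hM'0 hM0))
    · rw [hderiv]
      refine norm_add_le_of_le ?_ ?_ <;> rw [norm_smul, Real.norm_eq_abs]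
      · exact mul_le_mul (hM x).1 (hM' x).2 (norm_nonneg _) hM0
      · exact mul_le_mul (hM' x).1 (hM x).2 (norm_nonneg _) hM'0
    · rw [hderiv]
      exact W.add_mem (W.smul_mem _ (hhW x)) (W.smul_mem _ (hgW x))
  algebraMap_mem' r := by
    have hderiv (x : E) : fderiv ℝ (algebraMap ℝ (E → ℝ) r) x = 0 := fderiv_const_apply r
    refine ⟨contDiff_const, ⟨|r|, fun x => ⟨le_rfl, ?_⟩⟩, fun x => ?_⟩
    · rw [hderiv, norm_zero]
      exact abs_nonneg r
    · rw [hderiv]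
      exact W.zero_mem

theorem mem_boundedC1 {g : E → ℝ} : g ∈ boundedC1 W ↔ ContDiff ℝ 1 g ∧
    (∃ M, ∀ x, |g x| ≤ M ∧ ‖fderiv ℝ g x‖ ≤ M) ∧ ∀ x, fderiv ℝ g x ∈ W :=
  Iff.rfl

theorem boundedC1_mono (h : V ≤ W) : boundedC1 V ≤ boundedC1 W :=
  fun _ hg => ⟨hg.1, hg.2.1, fun x => h (hg.2.2 x)⟩

theorem comp_sub_mem_boundedC1 {g : E → ℝ} (hg : g ∈ boundedC1 W) (a : E) :
    (fun x => g (x - a)) ∈ boundedC1 W := by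
  obtain ⟨hg, ⟨M, hM⟩, hW⟩ := mem_boundedC1.1 hg
  simp only [mem_boundedC1, fderiv_comp_sub]
  exact ⟨hg.comp (contDiff_id.sub contDiff_const), ⟨M, fun x => hM (x - a)⟩, fun x => hW (x - a)⟩

theorem contDiffBump_comp_mem_boundedC1 {g : E → ℝ} {K : NNReal} (hgK : LipschitzWith K g) {a : E}
    (hg : ContDiffOn ℝ 1 g {a}ᶜ) (hW : ∀ x, x ≠ a → fderiv ℝ g x ∈ W) (θ : ContDiffBump (g a)) :
    (fun x => θ (g x)) ∈ boundedC1 W := by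
  have hg' (x : E) (hx : x ≠ a) : ContDiffAt ℝ 1 g x :=
    hg.contDiffAt (isOpen_compl_singleton.mem_nhds hx)
  have hone : (fun x => θ (g x)) =ᶠ[𝓝 a] fun _ => 1 :=
    hgK.continuous.continuousAt.eventually θ.eventuallyEq_one
  have hderiv (x : E) : fderiv ℝ (fun x => θ (g x)) x = 0 ∨
      x ≠ a ∧ fderiv ℝ (fun x => θ (g x)) x = deriv θ (g x) • fderiv ℝ g x := by
    rcases eq_or_ne x a with rfl | hx
    · exact .inl (by rw [hone.fderiv_eq, fderiv_const_apply])
    · exact .inr ⟨hx, (θ.contDiff.differentiable one_ne_zero _).hasDerivAt.comp_hasFDerivAt x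
        ((hg' x hx).differentiableAt one_ne_zero).hasFDerivAt |>.fderiv⟩
  obtain ⟨C, hC⟩ := (θ.contDiff.continuous_deriv le_rfl).bounded_above_of_compact_support
    θ.hasCompactSupport.deriv
  have hC0 : 0 ≤ C := (norm_nonneg _).trans (hC 0)
  refine mem_boundedC1.2 ⟨contDiff_iff_contDiffAt.2 fun x => ?_,
    ⟨max 1 (C * K), fun x => ⟨le_max_of_le_left ?_, le_max_of_le_right ?_⟩⟩, fun x => ?_⟩
  · rcases eq_or_ne x a with rfl | hx
    · exact contDiffAt_const.congr_of_eventuallyEq hone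
    · exact θ.contDiffAt.comp x (hg' x hx)
  · exact abs_le.2 ⟨neg_one_lt_zero.le.trans θ.nonneg, θ.le_one⟩
  · rcases hderiv x with h | ⟨-, h⟩ <;> rw [h]
    · rw [norm_zero]
      positivity
    · rw [norm_smul]
      exact mul_le_mul (hC _) (norm_fderiv_le_of_lipschitz ℝ hgK) (norm_nonneg _) hC0
  · rcases hderiv x with h | ⟨hx, h⟩ <;> rw [h]
    · exact W.zero_mem
    · exact W.smul_mem _ (hW x hx)

theorem IsEquivalentNorm.exists_lipschitzWith {N : Seminorm ℝ E} (hN : IsEquivalentNorm N) :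
    ∃ K, LipschitzWith K N := by
  obtain ⟨_, C, _, hC, hNC⟩ := hN
  exact ⟨⟨C, hC.le⟩, LipschitzWith.of_dist_le_mul fun x y => by
    rw [Real.dist_eq, dist_eq_norm]
    exact (abs_sub_map_le_sub N x y).trans (hNC _).2⟩

theorem IsEquivalentNorm.exists_cutoff_mem_boundedC1 {N : Seminorm ℝ E} (hN : IsEquivalentNorm N)
    (hC1 : IsC1Norm N) (hW : ∀ x, x ≠ 0 → fderiv ℝ N x ∈ W) {U : Set E} {a : E} (hU : U ∈ 𝓝 a) :
    ∃ b ∈ boundedC1 W, (∀ y, b y ∈ Icc (0 : ℝ) 1) ∧ (∀ᶠ y in 𝓝 a, b y = 1) ∧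
      Function.support b ⊆ U := by
  obtain ⟨K, hK⟩ := hN.exists_lipschitzWith
  obtain ⟨c, _, hc, _, hcN⟩ := hN
  obtain ⟨ρ, hρ, hρU⟩ := Metric.mem_nhds_iff.1 hU
  have hr : 0 < c * ρ := mul_pos hc hρ
  let θ : ContDiffBump (N 0) := ⟨c * ρ / 2, c * ρ, half_pos hr, half_lt_self hr⟩
  refine ⟨fun y => θ (N (y - a)),
    comp_sub_mem_boundedC1 (contDiffBump_comp_mem_boundedC1 hK hC1 hW θ) a,
    fun y => ⟨θ.nonneg, θ.le_one⟩, ?_, fun y hy => hρU ?_⟩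
  · have hcont : Tendsto (fun y => N (y - a)) (𝓝 a) (𝓝 (N 0)) :=
      (hK.continuous.comp (continuous_sub_right a)).tendsto' _ _ (by simp)
    exact hcont.eventually θ.eventuallyEq_one
  · have hlt : N (y - a) < c * ρ := by
      simpa [θ.support_eq, abs_of_nonneg (apply_nonneg N _)] using
        (show N (y - a) ∈ Function.support θ from hy)
    rw [Metric.mem_ball, dist_eq_norm]
    exact lt_of_mul_lt_mul_left ((hcN _).1.trans_lt hlt) hc.le

end BoundedC1

theorem exists_seq_iUnion_support_eq {X S : Type*} [TopologicalSpace X] [SecondCountableTopology X]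
    [SetLike S (X → ℝ)] [SubringClass S (X → ℝ)] {A : S} {U : Set X}
    (hA : ∀ a ∈ U, ∃ b ∈ A, (∀ y, b y ∈ Icc (0 : ℝ) 1) ∧ (∀ᶠ y in 𝓝 a, b y = 1) ∧
      Function.support b ⊆ U) :
    ∃ ψ : ℕ → X → ℝ, (∀ n, ψ n ∈ A) ∧ (∀ n y, 0 ≤ ψ n y) ∧ ⋃ n, Function.support (ψ n) = U ∧
      ∀ y ∈ U, ∃ m, ∀ᶠ z in 𝓝 y, ∀ n, m ≤ n → ψ n z = 0 := by
  rcases U.eq_empty_or_nonempty with rfl | hU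
  · exact ⟨0, fun _ => zero_mem A, fun _ _ => le_rfl, by simp, by simp⟩
  choose b hbA hb hb1 hbU using fun a : U => hA a a.2
  obtain ⟨t, htc, ht⟩ := TopologicalSpace.countable_cover_nhds fun a : U =>
    continuousAt_subtype_val.eventually (hb1 a).eventually_nhds
  have hlocal (y : U) : ∃ a ∈ t, ∀ᶠ z in 𝓝 (y : X), b a z = 1 := by
    simpa using ht.ge (mem_univ y)
  have htne : t.Nonempty := (hlocal ⟨hU.some, hU.some_mem⟩).imp fun _ h => h.1
  obtain ⟨a, rfl⟩ := htc.exists_eq_range htne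
  refine ⟨fun n => b (a n) * ∏ j ∈ Finset.range n, (1 - b (a j)), fun n => ?_, fun n y => ?_,
    subset_antisymm (iUnion_subset fun n y hy => ?_) fun y hy => ?_, fun y hy => ?_⟩
  · exact mul_mem (hbA _) (prod_mem fun j _ => sub_mem (one_mem A) (hbA _))
  · simp only [Pi.mul_apply, Finset.prod_apply, Pi.sub_apply, Pi.one_apply]
    exact mul_nonneg (hb _ y).1 (Finset.prod_nonneg fun j _ => sub_nonneg.2 (hb _ y).2)
  · exact hbU (a n) (left_ne_zero_of_mul hy)
  · classical
    have hex : ∃ n, b (a n) y = 1 := by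
      obtain ⟨-, ⟨n, rfl⟩, hn⟩ := hlocal ⟨y, hy⟩
      exact ⟨n, hn.self_of_nhds⟩
    refine mem_iUnion.2 ⟨Nat.find hex, ?_⟩
    simp only [Function.mem_support, Pi.mul_apply, Finset.prod_apply, Pi.sub_apply, Pi.one_apply,
      Nat.find_spec hex, one_mul, Finset.prod_ne_zero_iff, sub_ne_zero]
    exact fun j hj h => Nat.find_min hex (Finset.mem_range.1 hj) h.symm
  · obtain ⟨-, ⟨m, rfl⟩, hm⟩ := hlocal ⟨y, hy⟩
    refine ⟨m + 1, hm.mono fun z hz n hn => ?_⟩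
    simp only [Pi.mul_apply, Finset.prod_apply, Pi.sub_apply, Pi.one_apply]
    rw [Finset.prod_eq_zero (Finset.mem_range.2 hn) (by rw [hz, sub_self]), mul_zero]

section TiltedSeries

variable {E : Type*} [NormedAddCommGroup E] [NormedSpace ℝ E]

/-- A positive bounded `C¹` function of `f` whose derivative is everywhere a positive multiple of
`f`. Multiplying a cutoff function by it adds a component along `f` to the derivative. -/
noncomputable def tilt (f : StrongDual ℝ E) (x : E) : ℝ :=
  2 + Real.arctan (f x)

theorem tilt_pos (f : StrongDual ℝ E) (x : E) : 0 < tilt f x := by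
  unfold tilt
  linarith [Real.neg_pi_div_two_lt_arctan (f x), Real.pi_lt_four]

theorem hasFDerivAt_tilt (f : StrongDual ℝ E) (x : E) :
    HasFDerivAt (tilt f) ((1 + f x ^ 2)⁻¹ • f) x := by
  rw [← one_div]
  exact f.hasFDerivAt.arctan.const_add 2

theorem tilt_mem_boundedC1 (f : StrongDual ℝ E) : tilt f ∈ boundedC1 ⊤ := by
  refine mem_boundedC1.2 ⟨contDiff_const.add f.contDiff.arctan,
    ⟨max 4 ‖f‖, fun x => ⟨le_max_of_le_left ?_, le_max_of_le_right ?_⟩⟩, fun _ => trivial⟩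
  · rw [abs_of_pos (tilt_pos f x), tilt]
    linarith [Real.arctan_lt_pi_div_two (f x), Real.pi_lt_four]
  · rw [(hasFDerivAt_tilt f x).fderiv, norm_smul, norm_inv, Real.norm_of_nonneg (by positivity)]
    exact mul_le_of_le_one_left (norm_nonneg f)
      (inv_le_one_of_one_le₀ (le_add_of_nonneg_right (sq_nonneg _)))

variable {W : Submodule ℝ (StrongDual ℝ E)}

theorem mkQ_fderiv_mul_tilt {ψ : E → ℝ} {x : E} (hψ : DifferentiableAt ℝ ψ x)
    (hW : fderiv ℝ ψ x ∈ W) (f : StrongDual ℝ E) :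
    W.mkQ (fderiv ℝ (fun y => ψ y * tilt f y) x) = (ψ x * (1 + f x ^ 2)⁻¹) • W.mkQ f := by
  have hzero : W.mkQ (fderiv ℝ ψ x) = 0 := (Submodule.Quotient.mk_eq_zero W).2 hW
  rw [fderiv_fun_mul hψ (hasFDerivAt_tilt f x).differentiableAt, (hasFDerivAt_tilt f x).fderiv,
    map_add, map_smul, map_smul, map_smul, hzero, smul_zero, add_zero, smul_smul]

theorem fderiv_sum_mul_tilt_ne_zero {ι : Type*} {f : ι → StrongDual ℝ E}
    (hf : LinearIndependent ℝ fun i => W.mkQ (f i)) {ψ : ι → E → ℝ} {x : E}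
    (hψ : ∀ i, DifferentiableAt ℝ (ψ i) x) (hW : ∀ i, fderiv ℝ (ψ i) x ∈ W) {c : ι → ℝ}
    {s : Finset ι} {i : ι} (hi : i ∈ s) (hc : c i ≠ 0) (hψi : ψ i x ≠ 0) :
    fderiv ℝ (fun y => ∑ j ∈ s, c j * (ψ j y * tilt (f j) y)) x ≠ 0 := by
  intro hzero
  have hdiff (j : ι) : DifferentiableAt ℝ (fun y => ψ j y * tilt (f j) y) x :=
    (hψ j).mul (hasFDerivAt_tilt (f j) x).differentiableAt
  have hsum : ∑ j ∈ s, (c j * (ψ j x * (1 + f j x ^ 2)⁻¹)) • W.mkQ (f j) = 0 := by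
    rw [← map_zero W.mkQ, ← hzero, fderiv_fun_sum fun j _ => (hdiff j).const_mul (c j), map_sum]
    refine Finset.sum_congr rfl fun j _ => ?_
    rw [fderiv_const_mul (hdiff j), map_smul, mkQ_fderiv_mul_tilt (hψ j) (hW j), smul_smul]
  have hcoeff := linearIndependent_iff'.1 hf s _ hsum i hi
  exact mul_ne_zero hc (mul_ne_zero hψi (by positivity)) hcoeff

theorem exists_pos_contDiff_tsum_mul {g : ℕ → E → ℝ} (hg : ∀ n, g n ∈ boundedC1 ⊤) :
    ∃ c : ℕ → ℝ, (∀ n, 0 < c n) ∧ (∀ x, Summable fun n => c n * g n x) ∧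
      ContDiff ℝ 1 fun x => ∑' n, c n * g n x := by
  choose hC1 hbound _ using fun n => mem_boundedC1.1 (hg n)
  choose M hM using hbound
  have hM0 (n : ℕ) : 0 < M n + 1 :=
    add_pos_of_nonneg_of_pos ((abs_nonneg _).trans (hM n 0).1) one_pos
  let c : ℕ → ℝ := fun n => (1 / 2) ^ n / (M n + 1)
  have hc (n : ℕ) : 0 < c n := div_pos (by positivity) (hM0 n)
  have hcM {n : ℕ} {t : ℝ} (ht : t ≤ M n) : c n * t ≤ (1 / 2) ^ n := by
    rw [div_mul_eq_mul_div, div_le_iff₀ (hM0 n)]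
    gcongr
    linarith
  have hterm (n : ℕ) (x : E) : ‖c n * g n x‖ ≤ (1 / 2) ^ n := by
    rw [norm_mul, Real.norm_of_nonneg (hc n).le]
    exact hcM (hM n x).1
  have hderiv (n : ℕ) (x : E) : ‖fderiv ℝ (fun x => c n * g n x) x‖ ≤ (1 / 2) ^ n := by
    rw [fderiv_const_mul ((hC1 n).differentiable one_ne_zero x), norm_smul,
      Real.norm_of_nonneg (hc n).le]
    exact hcM (hM n x).2
  refine ⟨c, hc, fun x => summable_geometric_two.of_norm_bounded fun n => hterm n x,
    contDiff_tsum (N := 1) (v := fun _ n => (1 / 2) ^ n) (fun n => contDiff_const.mul (hC1 n))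
      (fun _ _ => summable_geometric_two) fun k n x hk => ?_⟩
  have hk' : k ≤ 1 := by exact_mod_cast hk
  interval_cases k
  · exact norm_iteratedFDeriv_zero.trans_le (hterm n x)
  · exact (norm_iteratedFDeriv_one _).trans_le (hderiv n x)

theorem exists_contDiff_support_eq_iUnion_fderiv_ne_zero {f : ℕ → StrongDual ℝ E}
    (hf : LinearIndependent ℝ fun n => W.mkQ (f n)) {ψ : ℕ → E → ℝ}
    (hψ : ∀ n, ψ n ∈ boundedC1 W) (hψ0 : ∀ n x, 0 ≤ ψ n x) {U : Set E}
    (hU : ⋃ n, Function.support (ψ n) = U)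
    (hfin : ∀ x ∈ U, ∃ m, ∀ᶠ y in 𝓝 x, ∀ n, m ≤ n → ψ n y = 0) :
    ∃ lam : E → ℝ, ContDiff ℝ 1 lam ∧ (∀ x, 0 ≤ lam x) ∧ Function.support lam = U ∧
      ∀ x ∈ U, fderiv ℝ lam x ≠ 0 := by
  have hmem {x : E} : x ∈ U ↔ ∃ n, ψ n x ≠ 0 := by simp [← hU]
  let g : ℕ → E → ℝ := fun n x => ψ n x * tilt (f n) x
  obtain ⟨c, hc, hsummable, hC1⟩ := exists_pos_contDiff_tsum_mul (g := g) fun n =>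
    mul_mem (boundedC1_mono le_top (hψ n)) (tilt_mem_boundedC1 (f n))
  have hg0 (x : E) (n : ℕ) : 0 ≤ c n * g n x :=
    mul_nonneg (hc n).le (mul_nonneg (hψ0 n x) (tilt_pos _ x).le)
  refine ⟨_, hC1, fun x => tsum_nonneg (hg0 x), ext fun x => ?_, fun x hx => ?_⟩
  · rw [Function.mem_support, hmem, Ne, ← (hsummable x).hasSum_iff,
      hasSum_zero_iff_of_nonneg (hg0 x), funext_iff, not_forall]
    simp [g, (hc _).ne', (tilt_pos _ x).ne']
  · obtain ⟨m, hm⟩ := hfin x hx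
    obtain ⟨n, hn⟩ := hmem.1 hx
    have hnm : n < m := lt_of_not_ge fun h => hn (hm.self_of_nhds n h)
    have hlocal : (fun y => ∑' n, c n * g n y) =ᶠ[𝓝 x]
        fun y => ∑ n ∈ Finset.range m, c n * g n y := hm.mono fun y hy =>
      tsum_eq_sum fun k hk => by simp [g, hy k (by simpa using hk)]
    rw [hlocal.fderiv_eq]
    exact fderiv_sum_mul_tilt_ne_zero hf (fun k => (hψ k).1.differentiable one_ne_zero x)
      (fun k => (hψ k).2.2 x) (Finset.mem_range.2 hnm) (hc n).ne' hn

end TiltedSeries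

section GaugeOfSublevelSet

theorem sublevel_mem_nhds {X : Type*} [TopologicalSpace X] {g : X → ℝ} {a : X} {c : ℝ}
    (hcont : Continuous g) (ha : g a < c) : {y | g y ≤ c} ∈ 𝓝 a :=
  (hcont.continuousAt.eventually_lt continuousAt_const ha).mono fun _ => le_of_lt

variable {E : Type*} {Φ : E → ℝ} {c : ℝ} {x : E}

section Topological

variable [AddCommGroup E] [Module ℝ E] [TopologicalSpace E] [IsTopologicalAddGroup E]
  [ContinuousSMul ℝ E]

theorem gauge_sublevel_eq_one_iff (hconv : ConvexOn ℝ univ Φ) (hcont : Continuous Φ)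
    (h0 : Φ 0 < c) : gauge {y | Φ y ≤ c} x = 1 ↔ Φ x = c := by
  have hnhds := sublevel_mem_nhds hcont h0
  have hconvex : Convex ℝ {y | Φ y ≤ c} := by simpa using hconv.convex_le c
  refine ⟨fun h => ?_, fun h =>
    (gauge_le_one_of_mem (show x ∈ {y | Φ y ≤ c} from h.le)).eq_of_not_lt fun hlt => ?_⟩
  · exact frontier_le_subset_eq hcont continuous_const
      ((gauge_eq_one_iff_mem_frontier hconvex hnhds).1 h)
  · obtain ⟨y, hy, a, b, ha, hb, hab, rfl⟩ :=
      mem_openSegment_of_gauge_lt_one (absorbent_nhds_zero hnhds) hlt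
    have hle := hconv.2 (mem_univ 0) (mem_univ y) ha.le hb.le hab
    have ha0 : a * Φ 0 < a * c := mul_lt_mul_of_pos_left h0 ha
    have hby : b * Φ y ≤ b * c := mul_le_mul_of_nonneg_left hy hb.le
    refine hle.not_gt ?_
    rw [h, smul_eq_mul, smul_eq_mul]
    calc a * Φ 0 + b * Φ y < a * c + b * c := add_lt_add_of_lt_of_le ha0 hby
      _ = c := by rw [← add_mul, hab, one_mul]

theorem gauge_sublevel_eq_inv_iff (hconv : ConvexOn ℝ univ Φ) (hcont : Continuous Φ)
    (h0 : Φ 0 < c) {t : ℝ} (ht : 0 < t) : gauge {y | Φ y ≤ c} x = t⁻¹ ↔ Φ (t • x) = c := by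
  rw [← gauge_sublevel_eq_one_iff hconv hcont h0, gauge_smul_of_nonneg ht.le, smul_eq_mul,
    mul_eq_one_iff_inv_eq₀ ht.ne', eq_comm]

end Topological

variable [NormedAddCommGroup E] [NormedSpace ℝ E]

theorem DependsOnFinitelyManyFunctionalsAt.gauge_sublevel (hconv : ConvexOn ℝ univ Φ)
    (hcont : Continuous Φ) (h0 : Φ 0 < c) (hx : 0 < gauge {y | Φ y ≤ c} x)
    (hΦ : DependsOnFinitelyManyFunctionalsAt ℝ Φ ((gauge {y | Φ y ≤ c} x)⁻¹ • x)) :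
    DependsOnFinitelyManyFunctionalsAt ℝ (gauge {y | Φ y ≤ c}) x := by
  set p := gauge {y | Φ y ≤ c}
  have hp : Continuous p := continuous_gauge (by simpa using hconv.convex_le c)
    (sublevel_mem_nhds hcont h0)
  obtain ⟨s, hs⟩ := hΦ
  have hnormalize : Tendsto (fun q : E × E => ((p q.1)⁻¹ • q.1, (p q.1)⁻¹ • q.2)) (𝓝 (x, x))
      (𝓝 ((p x)⁻¹ • x, (p x)⁻¹ • x)) := by
    have hinv : ContinuousAt (fun q : E × E => (p q.1)⁻¹) (x, x) :=
      (hp.comp continuous_fst).continuousAt.inv₀ hx.ne'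
    exact (hinv.smul continuousAt_fst).prodMk (hinv.smul continuousAt_snd)
  have hpos : ∀ᶠ q : E × E in 𝓝 (x, x), 0 < p q.1 :=
    continuousAt_const.eventually_lt (hp.comp continuous_fst).continuousAt hx
  refine ⟨s, ?_⟩
  filter_upwards [hnormalize.eventually hs, hpos] with ⟨y, z⟩ hyz hy hL
  have hΦyz : Φ ((p y)⁻¹ • y) = Φ ((p y)⁻¹ • z) :=
    hyz fun L hLs => by rw [map_smul, map_smul, hL L hLs]
  have hiff (w : E) := gauge_sublevel_eq_inv_iff (x := w) hconv hcont h0 (inv_pos.2 hy)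
  simp only [inv_inv] at hiff
  exact ((hiff z).2 (hΦyz ▸ (hiff y).1 rfl)).symm

theorem deriv_pos_of_convexOn {S : Set ℝ} {φ : ℝ → ℝ} (hφ : ConvexOn ℝ S φ) {φ' s t : ℝ}
    (hs : s ∈ S) (ht : t ∈ S) (hst : s < t) (hlt : φ s < φ t) (hφ' : HasDerivAt φ φ' t) :
    0 < φ' :=
  ((slope_pos_iff hst).2 hlt).trans_le (hφ.slope_le_of_hasDerivAt hs ht hst hφ')

theorem contDiffAt_gauge_sublevel [CompleteSpace E] {n : WithTop ℕ∞} (hn : n ≠ 0)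
    (hconv : ConvexOn ℝ univ Φ) (hΦ : ContDiff ℝ n Φ) (h0 : Φ 0 < c)
    (hx : 0 < gauge {y | Φ y ≤ c} x) : ContDiffAt ℝ n (gauge {y | Φ y ≤ c}) x := by
  set p := gauge {y | Φ y ≤ c}
  have hiff {y : E} {t : ℝ} (ht : 0 < t) : p y = t⁻¹ ↔ Φ (t • y) = c :=
    gauge_sublevel_eq_inv_iff hconv hΦ.continuous h0 ht
  let F : E × ℝ → ℝ := fun q => Φ (q.2 • q.1)
  set t := (p x)⁻¹
  have ht0 : 0 < t := inv_pos.2 hx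
  have hFx : F (x, t) = c := (hiff ht0).1 (inv_inv (p x)).symm
  have hF : ContDiffAt ℝ n F (x, t) := (hΦ.comp (contDiff_snd.smul contDiff_fst)).contDiffAt
  have hray : HasDerivAt (fun r : ℝ => Φ (r • x)) (fderiv ℝ F (x, t) (0, 1)) t :=
    (hF.differentiableAt hn).hasFDerivAt.comp_hasDerivAt t
      ((hasDerivAt_const t x).prodMk (hasDerivAt_id t))
  have hpos : 0 < fderiv ℝ F (x, t) (0, 1) := by
    have hconvray : ConvexOn ℝ univ fun r : ℝ => Φ (r • x) :=
      hconv.comp_linearMap (LinearMap.toSpanSingleton ℝ E x)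
    refine deriv_pos_of_convexOn hconvray (mem_univ 0) (mem_univ t) ht0 ?_ hray
    simpa using h0.trans_eq hFx.symm
  have hinv : (fderiv ℝ F (x, t) ∘L .inr ℝ E ℝ).IsInvertible := by
    refine ⟨ContinuousLinearEquiv.unitsEquivAut ℝ (Units.mk0 _ hpos.ne'), ?_⟩
    ext
    simp
  have himplicit := hF.contDiffAt_implicitFunction hn hinv
  have happly : hF.implicitFunction hn hinv x = t := hF.implicitFunction_apply_self hn hinv
  have hposnear : ∀ᶠ y in 𝓝 x, 0 < hF.implicitFunction hn hinv y :=
    continuousAt_const.eventually_lt himplicit.continuousAt (by rwa [happly])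
  refine (himplicit.inv (by rw [happly]; exact ht0.ne')).congr_of_eventuallyEq ?_
  filter_upwards [hposnear, hF.eventually_apply_implicitFunction hn hinv] with y hy hFy
  exact (hiff hy).2 (hFy.trans hFx)

end GaugeOfSublevelSet

section Excess

theorem hasDerivAt_max_zero_sq (t : ℝ) : HasDerivAt (fun s : ℝ => max s 0 ^ 2) (2 * max t 0) t := by
  rcases lt_trichotomy t 0 with ht | rfl | ht
  · rw [max_eq_right ht.le, mul_zero]
    refine (hasDerivAt_const t (0 : ℝ)).congr_of_eventuallyEq ?_
    filter_upwards [Iio_mem_nhds ht] with s hs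
    rw [max_eq_right (mem_Iio.1 hs).le, zero_pow two_ne_zero]
  · have hO : (fun s : ℝ => max s 0 ^ 2) =O[𝓝 0] fun s => s ^ 2 :=
      .of_norm_le fun s => by
        rw [norm_pow, Real.norm_of_nonneg (le_max_right s 0), ← sq_abs s]
        exact pow_le_pow_left₀ (le_max_right _ _) (max_le (le_abs_self s) (abs_nonneg s)) 2
    rw [max_self, mul_zero, hasDerivAt_iff_isLittleO]
    simpa using hO.trans_isLittleO (Asymptotics.isLittleO_pow_id one_lt_two)
  · rw [max_eq_left ht.le]
    refine HasDerivAt.congr_of_eventuallyEq (f := fun s : ℝ => s ^ 2)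
      (by simpa using hasDerivAt_pow 2 t) ?_
    filter_upwards [Ioi_mem_nhds ht] with s hs
    rw [max_eq_left (mem_Ioi.1 hs).le]

theorem contDiff_one_max_zero_sq : ContDiff ℝ 1 fun t : ℝ => max t 0 ^ 2 := by
  rw [contDiff_one_iff_deriv]
  refine ⟨fun t => (hasDerivAt_max_zero_sq t).differentiableAt, ?_⟩
  rw [funext fun t => (hasDerivAt_max_zero_sq t).deriv]
  fun_prop

/-- An even convex `C^1` function on the line that vanishes exactly on `[-1, 1]`. Since it is flat
there, coordinates of modulus at most `1` are invisible to sums of its values. -/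
def excess (a : ℝ) : ℝ := max (a ^ 2 - 1) 0 ^ 2

theorem excess_nonneg (a : ℝ) : 0 ≤ excess a := sq_nonneg _

theorem excess_neg (a : ℝ) : excess (-a) = excess a := by rw [excess, neg_sq, excess]

theorem excess_eq_zero {a : ℝ} (ha : |a| ≤ 1) : excess a = 0 := by
  rw [excess, max_eq_right (sub_nonpos.2 ((sq_le_one_iff_abs_le_one a).2 ha)),
    zero_pow two_ne_zero]

theorem abs_le_two_of_excess_le_one {a : ℝ} (ha : excess a ≤ 1) : |a| ≤ 2 := by
  have h : a ^ 2 - 1 ≤ 1 :=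
    (le_max_left _ 0).trans ((sq_le_one_iff₀ (le_max_right _ _)).1 ha)
  exact abs_le_of_sq_le_sq (by linarith) zero_le_two

theorem convexOn_excess : ConvexOn ℝ univ excess :=
  ((even_two.convexOn_pow.sub (concaveOn_const 1 convex_univ)).sup
    (convexOn_const 0 convex_univ)).pow (fun _ _ => le_max_right _ _) 2

theorem contDiff_excess : ContDiff ℝ 1 excess :=
  contDiff_one_max_zero_sq.comp ((contDiff_id.pow 2).sub contDiff_const)

end Excess

namespace NullSequence

variable {ι : Type*} [TopologicalSpace ι]

theorem abs_apply_le_norm (x : C₀(ι, ℝ)) (n : ι) : |x n| ≤ ‖x‖ :=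
  x.toBCF.norm_coe_le_norm n

theorem norm_le {x : C₀(ι, ℝ)} {C : ℝ} (hC : 0 ≤ C) (h : ∀ n, |x n| ≤ C) : ‖x‖ ≤ C :=
  (BoundedContinuousFunction.norm_le hC (f := x.toBCF)).2 h

/-- Evaluation at a point, as a continuous linear functional on `C₀(ι, ℝ)`. -/
noncomputable def coord (n : ι) : StrongDual ℝ C₀(ι, ℝ) :=
  LinearMap.mkContinuous
    { toFun := fun x => x n
      map_add' := fun _ _ => rfl
      map_smul' := fun _ _ => rfl } 1
    fun x => by simpa using abs_apply_le_norm x n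

@[simp]
theorem coord_apply (n : ι) (x : C₀(ι, ℝ)) : coord n x = x n := rfl

/-- The sum of the excesses of the coordinates. For discrete `ι` all but finitely many terms
vanish; otherwise the series may diverge, and `excessSum x` is then `0`. -/
noncomputable def excessSum (x : C₀(ι, ℝ)) : ℝ := ∑' n, excess (x n)

theorem excessSum_neg (x : C₀(ι, ℝ)) : excessSum (-x) = excessSum x :=
  tsum_congr fun n => excess_neg (x n)

theorem excessSum_eq_zero {x : C₀(ι, ℝ)} (hx : ‖x‖ ≤ 1) : excessSum x = 0 := by
  rw [excessSum, funext fun n => excess_eq_zero ((abs_apply_le_norm x n).trans hx), tsum_zero]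

theorem excessSum_zero_lt_one : excessSum (0 : C₀(ι, ℝ)) < 1 := by
  rw [excessSum_eq_zero (by simp)]
  exact one_pos

variable [DiscreteTopology ι]

theorem finite_le_abs (x : C₀(ι, ℝ)) {δ : ℝ} (hδ : 0 < δ) : {n | δ ≤ |x n|}.Finite := by
  have hx : Tendsto x cofinite (𝓝 0) := by
    rw [← cocompact_eq_cofinite]
    exact x.zero_at_infty'
  refine (eventually_cofinite.1 (hx.eventually (Metric.ball_mem_nhds 0 hδ))).subset fun n hn => ?_
  simpa using hn

section UnitVectorBasis

variable [DecidableEq ι]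

/-- The unit vectors of `c₀(ι) = C₀(ι, ℝ)`, for a discrete space `ι`. -/
noncomputable def unitVec (n : ι) : C₀(ι, ℝ) where
  toFun := Pi.single n 1
  continuous_toFun := continuous_of_discreteTopology
  zero_at_infty' := by
    rw [cocompact_eq_cofinite]
    refine tendsto_const_nhds.congr' ?_
    filter_upwards [(finite_singleton n).compl_mem_cofinite] with m hm
    exact (Pi.single_eq_of_ne (M := fun _ => ℝ) (by simpa using hm) _).symm

theorem unitVec_apply (n m : ι) : unitVec n m = if m = n then 1 else 0 :=
  Pi.single_apply n (1 : ℝ) m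

theorem sum_smul_unitVec_apply (x : C₀(ι, ℝ)) (A : Finset ι) (m : ι) :
    (∑ n ∈ A, x n • unitVec n) m = if m ∈ A then x m else 0 := by
  rw [← coord_apply, map_sum]
  simp [unitVec_apply]

theorem hasSum_unitVec (x : C₀(ι, ℝ)) : HasSum (fun n => x n • unitVec n) x := by
  rw [HasSum, SummationFilter.unconditional_filter, Metric.tendsto_atTop]
  intro ε hε
  refine ⟨(finite_le_abs x (half_pos hε)).toFinset, fun A hA => ?_⟩
  rw [dist_eq_norm]
  refine (norm_le (half_pos hε).le fun m => ?_).trans_lt (half_lt_self hε)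
  rw [ZeroAtInftyContinuousMap.sub_apply, sum_smul_unitVec_apply]
  split_ifs with hm
  · simpa using (half_pos hε).le
  · have hxm : |x m| < ε / 2 := not_le.1 fun h => hm (hA (by simpa using h))
    simpa using hxm.le

/-- The unit vector basis of `c₀(ι)`. -/
noncomputable def unitVecBasis : UnconditionalSchauderBasis ι ℝ C₀(ι, ℝ) where
  basis := unitVec
  coord := coord
  ortho i j := by simp [unitVec_apply, Pi.single_apply]
  expansion := hasSum_unitVec

end UnitVectorBasis

theorem not_finiteDimensional [Infinite ι] : ¬ FiniteDimensional ℝ C₀(ι, ℝ) := by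
  classical
  exact fun _ => not_finite_iff_infinite.2 ‹Infinite ι› unitVecBasis.linearIndependent.finite

section ExcessSum

theorem exists_finset_eventually_excess_eq_zero (z : C₀(ι, ℝ)) :
    ∃ A : Finset ι, ∀ᶠ y in 𝓝 z, ∀ n ∉ A, excess (y n) = 0 := by
  refine ⟨(finite_le_abs z one_half_pos).toFinset, ?_⟩
  filter_upwards [Metric.ball_mem_nhds z one_half_pos] with y hy n hn
  have hz : |z n| < 1 / 2 := by simpa using hn
  have hyz : |y n - z n| < 1 / 2 :=
    (abs_apply_le_norm (y - z) n).trans_lt (mem_ball_iff_norm.1 hy)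
  exact excess_eq_zero (by linarith [abs_sub_abs_le_abs_sub (y n) (z n)])

theorem exists_finset_eventually_excessSum_eq_sum (z : C₀(ι, ℝ)) :
    ∃ A : Finset ι, ∀ᶠ y in 𝓝 z, excessSum y = ∑ n ∈ A, excess (y n) := by
  obtain ⟨A, hA⟩ := exists_finset_eventually_excess_eq_zero z
  exact ⟨A, hA.mono fun y hy => tsum_eq_sum fun n hn => hy n hn⟩

theorem summable_excess (x : C₀(ι, ℝ)) : Summable fun n => excess (x n) := by
  obtain ⟨A, hA⟩ := exists_finset_eventually_excess_eq_zero x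
  exact summable_of_ne_finset_zero fun n hn => hA.self_of_nhds n hn

theorem norm_le_two_of_excessSum_le_one {x : C₀(ι, ℝ)} (hx : excessSum x ≤ 1) : ‖x‖ ≤ 2 :=
  norm_le zero_le_two fun n => abs_le_two_of_excess_le_one <|
    ((summable_excess x).le_tsum n fun _ _ => excess_nonneg _).trans hx

theorem convexOn_excessSum : ConvexOn ℝ univ (excessSum (ι := ι)) := by
  refine ⟨convex_univ, fun x _ y _ a b ha hb hab => ?_⟩
  rw [excessSum, excessSum, excessSum, ← (summable_excess x).tsum_const_smul,
    ← (summable_excess y).tsum_const_smul,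
    ← ((summable_excess x).const_smul a).tsum_add ((summable_excess y).const_smul b)]
  exact (summable_excess _).tsum_le_tsum
    (fun n => convexOn_excess.2 (mem_univ (x n)) (mem_univ (y n)) ha hb hab)
    (((summable_excess x).const_smul a).add ((summable_excess y).const_smul b))

theorem contDiff_excessSum : ContDiff ℝ 1 (excessSum (ι := ι)) := by
  refine contDiff_iff_contDiffAt.2 fun z => ?_
  obtain ⟨A, hA⟩ := exists_finset_eventually_excessSum_eq_sum z
  refine ContDiffAt.congr_of_eventuallyEq ?_ hA
  exact ContDiffAt.sum fun n _ => (contDiff_excess.comp (coord n).contDiff).contDiffAt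

theorem dependsOnFinitelyManyFunctionalsAt_excessSum (z : C₀(ι, ℝ)) :
    DependsOnFinitelyManyFunctionalsAt ℝ excessSum z := by
  classical
  obtain ⟨A, hA⟩ := exists_finset_eventually_excessSum_eq_sum z
  refine ⟨A.image coord, (hA.prod_nhds hA).mono fun p hp h => ?_⟩
  rw [hp.1, hp.2]
  exact Finset.sum_congr rfl fun n hn => congrArg excess (h _ (Finset.mem_image_of_mem coord hn))

end ExcessSum

section ExcessNorm

theorem absorbent_excessSum_le_one : Absorbent ℝ {x : C₀(ι, ℝ) | excessSum x ≤ 1} :=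
  absorbent_nhds_zero (𝕜 := ℝ) (E := C₀(ι, ℝ))
    (sublevel_mem_nhds contDiff_excessSum.continuous excessSum_zero_lt_one)

theorem convex_excessSum_le_one : Convex ℝ {x : C₀(ι, ℝ) | excessSum x ≤ 1} := by
  simpa using convexOn_excessSum.convex_le 1

theorem balanced_excessSum_le_one : Balanced ℝ {x : C₀(ι, ℝ) | excessSum x ≤ 1} :=
  (balanced_iff_neg_mem convex_excessSum_le_one).2 fun x hx => (excessSum_neg x).trans_le hx

/-- An equivalent `C^1` norm on `c₀(ι)` that locally depends on finitely many coordinates: the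
Minkowski functional of `{x | excessSum x ≤ 1}`. -/
noncomputable def excessNorm : Seminorm ℝ C₀(ι, ℝ) :=
  gaugeSeminorm balanced_excessSum_le_one convex_excessSum_le_one absorbent_excessSum_le_one

theorem excessNorm_le_norm (x : C₀(ι, ℝ)) : excessNorm x ≤ ‖x‖ := by
  have hball : Metric.ball 0 1 ⊆ {x : C₀(ι, ℝ) | excessSum x ≤ 1} := fun y hy =>
    (excessSum_eq_zero (mem_ball_zero_iff.1 hy).le).trans_le zero_le_one
  exact (one_mul _).symm.trans_le (mul_gauge_le_norm hball)

theorem norm_div_two_le_excessNorm (x : C₀(ι, ℝ)) : ‖x‖ / 2 ≤ excessNorm x :=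
  le_gauge_of_subset_closedBall absorbent_excessSum_le_one zero_le_two fun _ hy =>
    mem_closedBall_zero_iff.2 (norm_le_two_of_excessSum_le_one hy)

theorem excessNorm_pos {x : C₀(ι, ℝ)} (hx : x ≠ 0) : 0 < excessNorm x :=
  (half_pos (norm_pos_iff.2 hx)).trans_le (norm_div_two_le_excessNorm x)

theorem isEquivalentNorm_excessNorm : IsEquivalentNorm (excessNorm (ι := ι)) :=
  ⟨1 / 2, 1, one_half_pos, one_pos, fun x =>
    ⟨by linarith [norm_div_two_le_excessNorm x], by linarith [excessNorm_le_norm x]⟩⟩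

theorem isC1Norm_excessNorm : IsC1Norm (excessNorm (ι := ι)) := fun _ hx =>
  (contDiffAt_gauge_sublevel one_ne_zero convexOn_excessSum contDiff_excessSum
    excessSum_zero_lt_one (excessNorm_pos hx)).contDiffWithinAt

theorem locallyDependsOnFinitelyManyCoordinates_excessNorm :
    LocallyDependsOnFinitelyManyCoordinates (excessNorm (ι := ι)) :=
  locallyDependsOnFinitelyManyCoordinates_iff.2 fun _ hx =>
    (dependsOnFinitelyManyFunctionalsAt_excessSum _).gauge_sublevel convexOn_excessSum
      contDiff_excessSum.continuous excessSum_zero_lt_one (excessNorm_pos hx)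

end ExcessNorm

theorem hasC1FiniteCoordinateNorm : HasC1FiniteCoordinateNorm C₀(ℕ, ℝ) where
  infinite_dimensional := not_finiteDimensional
  unconditional_basis := ⟨unitVecBasis⟩
  exists_norm := ⟨excessNorm, isEquivalentNorm_excessNorm, isC1Norm_excessNorm,
    locallyDependsOnFinitelyManyCoordinates_excessNorm⟩

end NullSequence

theorem mainTheorem7_general {E : Type*} [NormedAddCommGroup E] [NormedSpace ℝ E]
    [TopologicalSpace.SeparableSpace E] (hE : ¬ FiniteDimensional ℝ E) {N : Seminorm ℝ E}
    (hN : IsEquivalentNorm N) (hC1 : IsC1Norm N) (hfin : LocallyDependsOnFinitelyManyCoordinates N)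
    {U : Set E} (hU : IsOpen U) :
    ∃ lam : E → ℝ, ContDiff ℝ 1 lam ∧ (∀ x, 0 ≤ lam x) ∧ Function.support lam = U ∧
      ∀ x ∈ U, Function.Surjective (fderiv ℝ lam x) := by
  have := UniformSpace.secondCountable_of_separable E
  obtain ⟨W, hWrank, hW⟩ := exists_rank_le_aleph0_forall_fderiv_mem (U := {0}ᶜ)
    (locallyDependsOnFinitelyManyCoordinates_iff.1 hfin)
  obtain ⟨f, hf⟩ := exists_linearIndependent_mkQ_of_rank_le_aleph0
    (fun _ => hE (finiteDimensional_of_strongDual (𝕜 := ℝ))) hWrank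
  obtain ⟨ψ, hψ, hψ0, hψU, hψfin⟩ := exists_seq_iUnion_support_eq (A := boundedC1 W) fun a ha =>
    hN.exists_cutoff_mem_boundedC1 hC1 hW (hU.mem_nhds ha)
  obtain ⟨lam, hlam, hlam0, hsupp, hfderiv⟩ :=
    exists_contDiff_support_eq_iUnion_fderiv_ne_zero hf hψ hψ0 hψU hψfin
  exact ⟨lam, hlam, hlam0, hsupp, fun x hx =>
    LinearMap.surjective (f := (fderiv ℝ lam x).toLinearMap) fun h =>
      hfderiv x hx (ContinuousLinearMap.coe_injective h)⟩

theorem HasC1FiniteCoordinateNorm.exists_contDiff_tsupport_eq {E : Type*} [NormedAddCommGroup E]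
    [NormedSpace ℝ E] (h : HasC1FiniteCoordinateNorm E) {U : Set E} (hU : IsOpen U) :
    ∃ lam : E → ℝ, ContDiff ℝ 1 lam ∧ (∀ x, 0 ≤ lam x) ∧ tsupport lam = closure U ∧
      ∀ x ∈ U, Function.Surjective (fderiv ℝ lam x) := by
  obtain ⟨b⟩ := h.unconditional_basis
  obtain ⟨N, hN, hC1, hfin⟩ := h.exists_norm
  have := separableSpace_of_generalSchauderBasis b
  obtain ⟨lam, hlam, hlam0, hsupp, hsurj⟩ :=
    mainTheorem7_general h.infinite_dimensional hN hC1 hfin hU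
  exact ⟨lam, hlam, hlam0, by rw [tsupport, hsupp], hsurj⟩

theorem mainTheorem7 :
    (∀ (E : Type*) [NormedAddCommGroup E] [NormedSpace ℝ E] [CompleteSpace E],
      HasC1FiniteCoordinateNorm E →
      ∀ U : Set E, IsOpen U →
        ∃ lam : E → ℝ, ContDiff ℝ 1 lam ∧ (∀ x, 0 ≤ lam x) ∧ tsupport lam = closure U ∧
          ∀ x ∈ U, Function.Surjective (fderiv ℝ lam x)) ∧
    (HasC1FiniteCoordinateNorm C₀(ℕ, ℝ) ∧
      ∀ U : Set C₀(ℕ, ℝ), IsOpen U →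
        ∃ lam : C₀(ℕ, ℝ) → ℝ, ContDiff ℝ 1 lam ∧ (∀ x, 0 ≤ lam x) ∧ tsupport lam = closure U ∧
          ∀ x ∈ U, Function.Surjective (fderiv ℝ lam x)) :=
  ⟨fun _ _ _ _ h _ hU => h.exists_contDiff_tsupport_eq hU,
    NullSequence.hasC1FiniteCoordinateNorm,
    fun _ hU => NullSequence.hasC1FiniteCoordinateNorm.exists_contDiff_tsupport_eq hU⟩
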